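/- **Setting.** For $\epsilon\in[-\frac1{12},\frac1{12}]$ let $M^\epsilon$ be the $2\times2$ zero-sum game in which, when the min-player plays row $a$ and the max-player plays column $b$, the loss $\ell\in\{0,1\}$ (paid by the min-player) is drawn from the Bernoulli law whose parameter is the $(a,b)$ entry of $$\begin{pmatrix} \frac23-\epsilon & \frac13+\epsilon\\[2pt] \frac13&\frac23\end{pmatrix}.$$ For mixed policies $\mu,\nu$ (probability vectors on the rows and on the columns) let $L(\mu,\nu)$ be the expected loss, and let $EG(\mu,\nu)=\max_{\nu'}L(\mu,\nu')-\min_{\mu'}L(\mu',\nu)$ be the exploitability gap. The game is played in rounds $t=1,2,\dots$: given the past, the actions $a^t\sim\mu^t$ and $b^t\sim\nu^t$ are drawn independently, and then the loss $\ell^t$ is drawn from the law attached to $(a^t,b^t)$. A *learning sequence* consists of a law for an internal random variable $\omega$ (with values in an arbitrary measurable space) and of policies $\mu^t,\nu^t$ that are predictable, i.e. measurable functions of the past $(\omega,a^1,b^1,\ell^1,\dots,a^{t-1},b^{t-1},\ell^{t-1})$; it is chosen without knowledge of $\epsilon$. We assume that the sampled actions of the max-player are never observed, i.e. that $\mu^t$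 and $\nu^t$ are measurable with respect to $\sigma(\omega,a^1,\ell^1,\dots,a^{t-1},\ell^{t-1})$. For $p\in(0,\infty)$ and a real random variable $X$ put $\|X\|_p=\mathbb E[|X|^p]^{1/p}$, and let $\|X\|_\infty$ be the essential supremum of $|X|$. **Corollary.** Let $p\in(2,\infty]$. No learning sequence for which the actions of the max-player are unobserved achieves simultaneously on all the games $M^\epsilon$, $\epsilon\in[-\frac1{12},\frac1{12}]$, the $L^p$ last-iterate convergence rate $f^t=\frac1{236}\,t^{-1/4}$, even asymptotically. That is, for each such learning sequence there is an $\epsilon\in[-\frac1{12},\frac1{12}]$ such that, when it plays $M^\epsilon$, there is no $T_0$ with $\|EG(\mu^t,\nu^t)\|_p\le\frac1{236}\,t^{-1/4}$ for all $t\ge T_0$. -/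

import Mathlib

open MeasureTheory ProbabilityTheory
open scoped ENNReal unitInterval

noncomputable section

namespace BanditGame

/-- A zero-sum matrix game with stochastic losses in `[0,1]`: if the min-player plays `a` and the
max-player plays `b`, the loss is drawn from `lossLaw a b`. -/
structure MatrixGame (α β : Type*) where
  lossLaw : α → β → ProbabilityMeasure I

section Game

variable {α β : Type*} [Fintype α] [Fintype β]

/-- The mean loss `L(a, b)` of a pair of actions. -/
def MatrixGame.meanLoss (G : MatrixGame α β) (a : α) (b : β) : ℝ :=
  ∫ ℓ : I, (ℓ : ℝ) ∂(G.lossLaw a b : Measure I)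

/-- The expected loss `L(μ, ν)` of a profile of mixed policies. -/
def MatrixGame.expectedLoss (G : MatrixGame α β) (μ : stdSimplex ℝ α) (ν : stdSimplex ℝ β) : ℝ :=
  ∑ a, ∑ b, μ.1 a * ν.1 b * G.meanLoss a b

/-- The exploitability gap `max_{ν'} L(μ, ν') - min_{μ'} L(μ', ν)`. The extrema are over compact
simplices of continuous functions, so that they are attained when there is an action to play. -/
def MatrixGame.exploitabilityGap (G : MatrixGame α β) (μ : stdSimplex ℝ α) (ν : stdSimplex ℝ β) :
    ℝ :=
  (⨆ ν' : stdSimplex ℝ β, G.expectedLoss μ ν') - (⨅ μ' : stdSimplex ℝ α, G.expectedLoss μ' ν)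

end Game

/-- The parameter `x` of a Bernoulli law, for a real number `x ∈ [0,1]`, gives the Bernoulli law
on `[0,1]` with mass `x` at `1` and mass `1 - x` at `0`. -/
def bernoulliLoss (x : ℝ) (hx : x ∈ Set.Icc (0 : ℝ) 1) : ProbabilityMeasure I :=
  ⟨bernoulliMeasure (1 : I) (0 : I) ⟨x, hx⟩, inferInstance⟩

/-- The `2 × 2` game with Bernoulli losses of parameters
`2/3 - ε`, `1/3 + ε` (first row) and `1/3`, `2/3` (second row), for `ε ∈ [-1/12, 1/12]`.
The min-player chooses the row, the max-player the column. -/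
def hardGame (ε : Set.Icc (-1 / 12 : ℝ) (1 / 12)) : MatrixGame (Fin 2) (Fin 2) where
  lossLaw := !![
    bernoulliLoss (2 / 3 - ε.1) ⟨by linarith [ε.2.2], by linarith [ε.2.1]⟩,
      bernoulliLoss (1 / 3 + ε.1) ⟨by linarith [ε.2.1], by linarith [ε.2.2]⟩;
    bernoulliLoss (1 / 3) ⟨by norm_num, by norm_num⟩,
      bernoulliLoss (2 / 3) ⟨by norm_num, by norm_num⟩]

/-- What has happened in the first `t` rounds: the internal randomness `ω` of the players, and for
each round the action of the min-player, the action of the max-player and the loss. -/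
abbrev History (W α β : Type*) (t : ℕ) : Type _ := W × (Fin t → α × β × I)

/-- The part of a history that remains when the actions of the max-player are not observed:
`(ω, a¹, ℓ¹, …, aᵗ, ℓᵗ)`. -/
def observe {W α β : Type*} (t : ℕ) (h : History W α β t) : W × (Fin t → α × I) :=
  (h.1, fun i => ((h.2 i).1, (h.2 i).2.2))

/-- The history extended by one more round. -/
def extend {W α β : Type*} (t : ℕ) (x : History W α β t × (α × β × I)) : History W α β (t + 1) :=
  (x.1.1, Fin.snoc (α := fun _ => α × β × I) x.1.2 x.2)

/-- A learning sequence: a law for the internal randomness of the players, and policies of both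
players that are predictable, that is, those of round `t + 1` are measurable functions of the
history of the first `t` rounds. The policies know nothing else about the game. -/
structure LearningSequence (W α β : Type*) [Fintype α] [Fintype β]
    [MeasurableSpace W] [MeasurableSpace α] [MeasurableSpace β] where
  /-- the law of the internal randomness -/
  seedLaw : ProbabilityMeasure W
  /-- the policy of the min-player in round `t + 1` -/
  minPolicy : (t : ℕ) → History W α β t → stdSimplex ℝ α
  /-- the policy of the max-player in round `t + 1` -/
  maxPolicy : (t : ℕ) → History W α β t → stdSimplex ℝ β
  measurable_minPolicy : ∀ t, Measurable (minPolicy t)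
  measurable_maxPolicy : ∀ t, Measurable (maxPolicy t)

namespace LearningSequence

variable {W α β : Type*} [Fintype α] [Fintype β]
  [MeasurableSpace W] [MeasurableSpace α] [MeasurableSpace β]

/-- The sampled actions of the max-player are never observed: the policies of both players in round
`t + 1` are measurable for the σ-algebra generated by `(ω, a¹, ℓ¹, …, aᵗ, ℓᵗ)`. -/
def MaxActionsUnobserved (S : LearningSequence W α β) : Prop :=
  ∀ t : ℕ,
    Measurable[MeasurableSpace.comap (observe (W := W) (α := α) (β := β) t) inferInstance]
      (S.minPolicy t) ∧
    Measurable[MeasurableSpace.comap (observe (W := W) (α := α) (β := β) t) inferInstance]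
      (S.maxPolicy t)

/-- The conditional law of round `t + 1` given the history: the actions are drawn independently
from the current policies of the two players, then the loss is drawn from the law that the game
attaches to them. -/
def stepKernel (S : LearningSequence W α β) (G : MatrixGame α β) (t : ℕ) :
    Kernel (History W α β t) (α × β × I) where
  toFun h := ∑ a, ∑ b, ENNReal.ofReal ((S.minPolicy t h).1 a * (S.maxPolicy t h).1 b) •
    (G.lossLaw a b : Measure I).map (fun ℓ => (a, b, ℓ))
  measurable' := by
    refine Measure.measurable_of_measurable_coe _ fun s hs => ?_
    simp only [Measure.coe_finsetSum, Finset.sum_apply, Measure.smul_apply, smul_eq_mul]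
    refine Finset.measurable_fun_sum _ fun a _ => Finset.measurable_fun_sum _ fun b _ => ?_
    refine Measurable.mul_const (ENNReal.measurable_ofReal.comp (Measurable.mul ?_ ?_)) _
    · exact (measurable_pi_apply a).comp (measurable_subtype_coe.comp (S.measurable_minPolicy t))
    · exact (measurable_pi_apply b).comp (measurable_subtype_coe.comp (S.measurable_maxPolicy t))

instance isMarkovKernel_stepKernel (S : LearningSequence W α β) (G : MatrixGame α β) (t : ℕ) :
    IsMarkovKernel (S.stepKernel G t) := by
  refine ⟨fun h => ⟨?_⟩⟩
  have hmap : ∀ a b, (G.lossLaw a b : Measure I).map (fun ℓ => (a, b, ℓ)) Set.univ = 1 := by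
    intro a b
    have hm : Measurable (fun ℓ : I => (a, b, ℓ)) := by fun_prop
    rw [Measure.map_apply hm MeasurableSet.univ]
    simp
  have hμ := (S.minPolicy t h).2
  have hν := (S.maxPolicy t h).2
  have hsum : ∑ a, ∑ b, (S.minPolicy t h).1 a * (S.maxPolicy t h).1 b = 1 := by
    simp only [← Finset.mul_sum, hν.2, mul_one, hμ.2]
  change (∑ a, ∑ b, ENNReal.ofReal ((S.minPolicy t h).1 a * (S.maxPolicy t h).1 b) •
    (G.lossLaw a b : Measure I).map (fun ℓ => (a, b, ℓ))) Set.univ = 1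
  simp only [Measure.coe_finsetSum, Finset.sum_apply, Measure.smul_apply, smul_eq_mul, hmap,
    mul_one]
  rw [← ENNReal.ofReal_one, ← hsum, ENNReal.ofReal_sum_of_nonneg
    fun a _ => Finset.sum_nonneg fun b _ => mul_nonneg (hμ.1 a) (hν.1 b)]
  exact Finset.sum_congr rfl fun a _ => (ENNReal.ofReal_sum_of_nonneg
    fun b _ => mul_nonneg (hμ.1 a) (hν.1 b)).symm

/-- The law of the first `t` rounds when the learning sequence `S` plays the game `G`. -/
def historyLaw (S : LearningSequence W α β) (G : MatrixGame α β) :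
    (t : ℕ) → Measure (History W α β t)
  | 0 => (S.seedLaw : Measure W).map fun w => (w, Fin.elim0)
  | t + 1 => (S.historyLaw G t ⊗ₘ S.stepKernel G t).map (extend t)

/-- The exploitability gap of the profile that is played in round `t + 1`. -/
def gap (S : LearningSequence W α β) (G : MatrixGame α β) (t : ℕ) (h : History W α β t) : ℝ :=
  G.exploitabilityGap (S.minPolicy t h) (S.maxPolicy t h)

/-- Asymptotic `L^p` last-iterate convergence of rate `f` on the game `G`: from some round on, the
`L^p` norm (the essential supremum if `p = ∞`) of the exploitability gap in round `n` is at most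
`f n`. Rounds are numbered from `1`. -/
def AsymptoticLastIterateConvergence (S : LearningSequence W α β) (G : MatrixGame α β)
    (p : ℝ≥0∞) (f : ℕ → ℝ) : Prop :=
  ∃ T₀ : ℕ, ∀ t ≥ T₀, eLpNorm (S.gap G t) p (S.historyLaw G t) ≤ ENNReal.ofReal (f (t + 1))

end LearningSequence

theorem measurable_extend {W α β : Type*} [MeasurableSpace W] [MeasurableSpace α]
    [MeasurableSpace β] (t : ℕ) : Measurable (extend (W := W) (α := α) (β := β) t) := by
  refine Measurable.prodMk (by fun_prop) (measurable_pi_lambda _ fun i => ?_)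
  refine Fin.lastCases ?_ (fun j => ?_) i
  · simpa [Fin.snoc_last] using measurable_snd
  · simp only [Fin.snoc_castSucc]
    fun_prop

instance isProbabilityMeasure_historyLaw {W α β : Type*} [Fintype α] [Fintype β]
    [MeasurableSpace W] [MeasurableSpace α] [MeasurableSpace β]
    (S : LearningSequence W α β) (G : MatrixGame α β) (t : ℕ) :
    IsProbabilityMeasure (S.historyLaw G t) := by
  induction t with
  | zero =>
    exact Measure.isProbabilityMeasure_map (Measurable.aemeasurable (by fun_prop))
  | succ t ih =>
    exact Measure.isProbabilityMeasure_map (measurable_extend t).aemeasurable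

end BanditGame

end

/-! The obstruction is a conflict between convergence and exploration. When the max-player plays
both columns with probability `1/2`, every loss is a fair coin, whatever the row and whatever `ε`.
So a small gap forces the max-player towards the one policy under which the observed data say
nothing about `ε`, while the min-player's optimal row probability does depend on `ε`.

Quantitatively, take two parameters at distance `Δ`. A round with first-column probability `y` costs
at most `4 Δ² (y - 1/2)²` of the Hellinger affinity of the two loss laws (`hellinger_step_ge`).
Under the rate `c t^(-1/4)`, the mean of `(y - 1/2)²` in round `t` is at most `36 c² t^(-1/2)`, so
over `t` rounds the two observed laws lose only `O(Δ² (c² √t + T))`, where `T` counts the initial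
rounds without guarantee (`one_le_lintegral_rootRatio_add`). For `t` of order `Δ⁻⁴` they are still
hard to tell apart, so in one of the games the min-player errs by a multiple of `Δ`
(`ofReal_mul_lintegral_rootRatio_le`). The rate allows only `c t^(-1/4)`, of order `c Δ`, which is
too little for `c = 1/236`; `abs_sub_mul_le_of_rate` states the resulting inequality.

Since `T` may depend on `ε`, two arbitrary games are not enough: uncountability gives one `T` shared
by infinitely many `ε`, and two of those are as close as desired relative to `T`. -/

namespace BanditGame

/-! ### The exploitability gap of the hard games -/

section Game

/-- The probability of a unit loss in `hardGame ε` when the min-player plays the row `a` and the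
max-player plays the first column with probability `y`. -/
noncomputable def lossProb (ε : ℝ) (a : Fin 2) (y : ℝ) : ℝ :=
  if a = 0 then 1 / 2 + (y - 1 / 2) * (1 / 3 - 2 * ε) else 1 / 2 - (y - 1 / 2) / 3

theorem lossProb_mem_Icc {ε y : ℝ} (hε : ε ∈ Set.Icc (-1 / 12 : ℝ) (1 / 12))
    (hy : y ∈ Set.Icc (0 : ℝ) 1) (a : Fin 2) :
    lossProb ε a y ∈ Set.Icc (1 / 4 : ℝ) (3 / 4) := by
  obtain ⟨h1, h2⟩ := hε
  obtain ⟨h3, h4⟩ := hy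
  unfold lossProb
  split_ifs
  · constructor <;> nlinarith
  · constructor <;> linarith

/-- Equality holds in the first row, and the second row does not involve `ε`. The factor `(y -
1/2)²` expresses that the uniform column policy reveals nothing. -/
theorem sq_lossProb_sub_le (ε₁ ε₂ y : ℝ) (a : Fin 2) :
    (lossProb ε₂ a y - lossProb ε₁ a y) ^ 2 ≤ 4 * (ε₁ - ε₂) ^ 2 * (y - 1 / 2) ^ 2 := by
  unfold lossProb
  split_ifs
  · apply le_of_eq
    ring
  · nlinarith [mul_nonneg (sq_nonneg (ε₁ - ε₂)) (sq_nonneg (y - 1 / 2))]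

@[fun_prop]
theorem measurable_lossProb (ε : ℝ) (a : Fin 2) : Measurable (lossProb ε a) := by
  unfold lossProb
  split_ifs <;> fun_prop

variable (ε : Set.Icc (-1 / 12 : ℝ) (1 / 12))

theorem lintegral_bernoulliLoss {x : ℝ} (hx : x ∈ Set.Icc (0 : ℝ) 1) {g : I → ℝ≥0∞}
    (hg : Measurable g) :
    ∫⁻ ℓ, g ℓ ∂(bernoulliLoss x hx : Measure I) =
      ENNReal.ofReal x * g 1 + ENNReal.ofReal (1 - x) * g 0 := by
  have h1 : ((unitInterval.toNNReal ⟨x, hx⟩ : NNReal) : ℝ≥0∞) = ENNReal.ofReal x := by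
    rw [ENNReal.ofReal, ENNReal.coe_inj]
    exact NNReal.eq (by simp [hx.1])
  have h2 : ((unitInterval.toNNReal (unitInterval.symm ⟨x, hx⟩) : NNReal) : ℝ≥0∞) =
      ENNReal.ofReal (1 - x) := by
    rw [ENNReal.ofReal, ENNReal.coe_inj]
    exact NNReal.eq (by simp [hx.2])
  change ∫⁻ ℓ, g ℓ ∂(bernoulliMeasure (1 : I) (0 : I) ⟨x, hx⟩) = _
  rw [bernoulliMeasure_def, lintegral_add_measure, lintegral_smul_measure, lintegral_smul_measure,
    lintegral_dirac' _ hg, lintegral_dirac' _ hg, ← h1, ← h2]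
  rfl

theorem integral_bernoulliLoss {x : ℝ} (hx : x ∈ Set.Icc (0 : ℝ) 1) :
    ∫ ℓ : I, (ℓ : ℝ) ∂(bernoulliLoss x hx : Measure I) = x := by
  rw [integral_eq_lintegral_of_nonneg_ae (Filter.Eventually.of_forall fun ℓ => ℓ.2.1)
    (by fun_prop), lintegral_bernoulliLoss hx (by fun_prop)]
  simp [hx.1]

theorem hardGame_expectedLoss (μ ν : stdSimplex ℝ (Fin 2)) :
    (hardGame ε).expectedLoss μ ν =
      μ.1 0 * lossProb ε 0 (ν.1 0) + (1 - μ.1 0) * lossProb ε 1 (ν.1 0) := by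
  have hμ := μ.2.2
  have hν := ν.2.2
  simp only [Fin.sum_univ_two] at hμ hν
  have hμ' : μ.1 1 = 1 - μ.1 0 := by linarith
  have hν' : ν.1 1 = 1 - ν.1 0 := by linarith
  have h00 : (hardGame ε).meanLoss 0 0 = 2 / 3 - ε := integral_bernoulliLoss _
  have h01 : (hardGame ε).meanLoss 0 1 = 1 / 3 + ε := integral_bernoulliLoss _
  have h10 : (hardGame ε).meanLoss 1 0 = 1 / 3 := integral_bernoulliLoss _
  have h11 : (hardGame ε).meanLoss 1 1 = 2 / 3 := integral_bernoulliLoss _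
  simp only [MatrixGame.expectedLoss, Fin.sum_univ_two, h00, h01, h10, h11, lossProb, hμ', hν']
  norm_num
  ring

theorem stdSimplex_apply_mem_Icc (μ : stdSimplex ℝ (Fin 2)) (a : Fin 2) :
    μ.1 a ∈ Set.Icc (0 : ℝ) 1 :=
  ⟨μ.2.1 a, (Finset.single_le_sum (fun i _ => μ.2.1 i) (Finset.mem_univ a)).trans_eq μ.2.2⟩

theorem hardGame_expectedLoss_mem_Icc (μ ν : stdSimplex ℝ (Fin 2)) :
    (hardGame ε).expectedLoss μ ν ∈ Set.Icc (0 : ℝ) 1 := by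
  rw [hardGame_expectedLoss]
  have h0 := lossProb_mem_Icc ε.2 (stdSimplex_apply_mem_Icc ν 0) 0
  have h1 := lossProb_mem_Icc ε.2 (stdSimplex_apply_mem_Icc ν 0) 1
  have hx := stdSimplex_apply_mem_Icc μ 0
  constructor <;> nlinarith [hx.1, hx.2, h0.1, h0.2, h1.1, h1.2]

theorem sub_le_exploitabilityGap (μ ν μ' ν' : stdSimplex ℝ (Fin 2)) :
    (hardGame ε).expectedLoss μ ν' - (hardGame ε).expectedLoss μ' ν ≤
      (hardGame ε).exploitabilityGap μ ν := by
  refine sub_le_sub (le_ciSup (f := fun ν' => (hardGame ε).expectedLoss μ ν') ⟨1, ?_⟩ ν')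
    (ciInf_le (f := fun μ' => (hardGame ε).expectedLoss μ' ν) ⟨0, ?_⟩ μ')
  · rintro _ ⟨ν', rfl⟩
    exact (hardGame_expectedLoss_mem_Icc ε μ ν').2
  · rintro _ ⟨μ', rfl⟩
    exact (hardGame_expectedLoss_mem_Icc ε μ' ν).1

/-- The four differences of pure deviations bound the exploitability gap from below. -/
theorem exploitabilityGap_ge (μ ν : stdSimplex ℝ (Fin 2)) :
    |μ.1 0 * (1 / 3 - ε) - 1 / 6| + max ((ν.1 0 - 1 / 2) / 3)
      (-((ν.1 0 - 1 / 2) * (1 / 3 - 2 * ε))) ≤ (hardGame ε).exploitabilityGap μ ν := by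
  let e : Fin 2 → stdSimplex ℝ (Fin 2) := fun i => ⟨Pi.single i 1, single_mem_stdSimplex ℝ i⟩
  have key : ∀ i j : Fin 2, (hardGame ε).expectedLoss μ (e j) -
      (hardGame ε).expectedLoss (e i) ν ≤ (hardGame ε).exploitabilityGap μ ν :=
    fun i j => sub_le_exploitabilityGap ε μ ν (e i) (e j)
  have h00 := key 0 0
  have h01 := key 0 1
  have h10 := key 1 0
  have h11 := key 1 1
  simp only [hardGame_expectedLoss, e, lossProb] at h00 h01 h10 h11
  norm_num at h00 h01 h10 h11
  rcases abs_cases (μ.1 0 * (1 / 3 - (ε : ℝ)) - 1 / 6) with ⟨h, _⟩ | ⟨h, _⟩ <;>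
  rcases max_cases ((ν.1 0 - 1 / 2) / 3) (-((ν.1 0 - 1 / 2) * (1 / 3 - 2 * (ε : ℝ))))
    with ⟨h', _⟩ | ⟨h', _⟩ <;> rw [h, h'] <;> linarith

/-- Both slopes `1/3` and `1/3 - 2ε` are at least `1/6`. This is what ties a small gap to
uninformative play. -/
theorem abs_colProb_sub_half_le (μ ν : stdSimplex ℝ (Fin 2)) :
    |ν.1 0 - 1 / 2| / 6 ≤ (hardGame ε).exploitabilityGap μ ν := by
  refine le_trans ?_ (exploitabilityGap_ge ε μ ν)
  have h0 := abs_nonneg (μ.1 0 * (1 / 3 - (ε : ℝ)) - 1 / 6)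
  have h1 := le_max_left ((ν.1 0 - 1 / 2) / 3) (-((ν.1 0 - 1 / 2) * (1 / 3 - 2 * (ε : ℝ))))
  have h2 := le_max_right ((ν.1 0 - 1 / 2) / 3) (-((ν.1 0 - 1 / 2) * (1 / 3 - 2 * (ε : ℝ))))
  rcases abs_cases (ν.1 0 - 1 / 2) with ⟨h, h'⟩ | ⟨h, h'⟩ <;> rw [h]
  · linarith
  · nlinarith [ε.2.2]

theorem abs_rowProb_error_le (μ ν : stdSimplex ℝ (Fin 2)) :
    |μ.1 0 * (1 / 3 - ε) - 1 / 6| ≤ (hardGame ε).exploitabilityGap μ ν := by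
  refine le_trans (le_add_of_nonneg_right ?_) (exploitabilityGap_ge ε μ ν)
  rcases le_total 0 (ν.1 0 - 1 / 2) with h | h
  · exact le_max_of_le_left (by linarith)
  · exact le_max_of_le_right (by nlinarith [ε.2.2])

/-- No row probability is nearly optimal for two different games at a time. -/
theorem abs_rowProb_error_add_ge {ε₁ ε₂ x : ℝ} (h₁ : ε₁ ∈ Set.Icc (-1 / 12 : ℝ) (1 / 12))
    (h₂ : ε₂ ∈ Set.Icc (-1 / 12 : ℝ) (1 / 12)) (hx : x ∈ Set.Icc (0 : ℝ) 1) :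
    |ε₁ - ε₂| / 5 ≤ |x * (1 / 3 - ε₁) - 1 / 6| + |x * (1 / 3 - ε₂) - 1 / 6| := by
  obtain ⟨h1, h2⟩ := h₁
  obtain ⟨h3, h4⟩ := h₂
  obtain ⟨h5, h6⟩ := hx
  -- For `x ≤ 1/5` the first error alone is at least `1/12`, more than `|ε₁ - ε₂| / 5 ≤ 1/30`.
  -- Otherwise the triangle inequality gives `x |ε₁ - ε₂|`.
  rcases le_total x (1 / 5) with h | h
  · have h7 : |ε₁ - ε₂| ≤ 1 / 6 := abs_le.2 ⟨by linarith, by linarith⟩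
    have h8 := neg_abs_le (x * (1 / 3 - ε₁) - 1 / 6)
    have h9 := abs_nonneg (x * (1 / 3 - ε₂) - 1 / 6)
    nlinarith
  · have h7 := abs_sub (x * (1 / 3 - ε₁) - 1 / 6) (x * (1 / 3 - ε₂) - 1 / 6)
    have h8 : x * (1 / 3 - ε₁) - 1 / 6 - (x * (1 / 3 - ε₂) - 1 / 6) = x * -(ε₁ - ε₂) := by ring
    rw [h8, abs_mul, abs_neg, abs_of_nonneg h5] at h7
    nlinarith [abs_nonneg (ε₁ - ε₂)]

end Game

/-! ### Scalar inequalities for the Hellinger affinity -/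

section Hellinger

/-- The deficit `(p + q)/2 - √(pq)` is `(√q - √p)²/2`, that is `(q - p)²/2` divided by `(√q + √p)²`,
and the divisor is at least `1` because both roots are at least `1/2`. -/
theorem one_sub_sq_sub_le_sqrt_mul_add {p q : ℝ} (hp : p ∈ Set.Icc (1 / 4 : ℝ) (3 / 4))
    (hq : q ∈ Set.Icc (1 / 4 : ℝ) (3 / 4)) :
    1 - (q - p) ^ 2 ≤ √(p * q) + √((1 - p) * (1 - q)) := by
  have key : ∀ {p q : ℝ}, p ∈ Set.Icc (1 / 4 : ℝ) (3 / 4) → q ∈ Set.Icc (1 / 4 : ℝ) (3 / 4) →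
      (p + q) / 2 - (q - p) ^ 2 / 2 ≤ √(p * q) := by
    intro p q hp hq
    have half_le : ∀ {r : ℝ}, 1 / 4 ≤ r → 1 / 2 ≤ √r := fun {r} hr =>
      Real.le_sqrt_of_sq_le (by linarith)
    have hp0 := hp.1
    have hq0 := hq.1
    have ep : √p ^ 2 = p := Real.sq_sqrt (by linarith)
    have eq : √q ^ 2 = q := Real.sq_sqrt (by linarith)
    rw [Real.sqrt_mul (by linarith)]
    have h1 : (q - p) ^ 2 = (√q - √p) ^ 2 * (√q + √p) ^ 2 := by
      nth_rewrite 1 [← ep, ← eq]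
      ring
    have h2 : 1 ≤ (√q + √p) ^ 2 := by nlinarith [half_le hp0, half_le hq0]
    have h3 := mul_le_mul_of_nonneg_left h2 (sq_nonneg (√q - √p))
    nlinarith
  have h1 := key hp hq
  have h2 := key (p := 1 - p) (q := 1 - q) ⟨by linarith [hp.2], by linarith [hp.1]⟩
    ⟨by linarith [hq.2], by linarith [hq.1]⟩
  nlinarith

/-- A pointwise lower bound that turns a bound on a Hellinger affinity into a bound on a total
variation distance. -/
theorem three_quarters_mul_le_min_add (s : ℝ) :
    3 / 4 * s ≤ min 1 (s ^ 2) + (1 + s ^ 2) / 8 := by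
  -- The differences of the two sides are the squares `(s - 3)²/8` and `(3s - 1)²/8`.
  rcases min_choice 1 (s ^ 2) with h | h <;> rw [h]
  · nlinarith [sq_nonneg (s - 3)]
  · nlinarith [sq_nonneg (3 * s - 1)]

end Hellinger

end BanditGame

/-! ### Reduction to the observed history -/

namespace BanditGame

/-- What the players know after `t` rounds when the actions of the max-player are not observed. -/
abbrev ObsHistory (W : Type*) (t : ℕ) : Type _ := W × (Fin t → Fin 2 × I)

section Observation

variable {W : Type*} {t : ℕ}

/-- An observed history extended by one more round. -/
def ObsHistory.append (o : ObsHistory W t) (z : Fin 2 × I) : ObsHistory W (t + 1) :=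
  (o.1, Fin.snoc (α := fun _ => Fin 2 × I) o.2 z)

/-- A history with a given observed part. -/
def ObsHistory.fill (o : ObsHistory W t) : History W (Fin 2) (Fin 2) t :=
  (o.1, fun i => ((o.2 i).1, 0, (o.2 i).2))

theorem observe_extend (h : History W (Fin 2) (Fin 2) t) (a b : Fin 2) (ℓ : I) :
    observe (t + 1) (extend t (h, a, b, ℓ)) =
      ObsHistory.append (observe t h : ObsHistory W t) (a, ℓ) := by
  refine Prod.ext rfl (funext fun i => ?_)
  refine Fin.lastCases ?_ (fun j => ?_) i <;> simp [observe, extend, ObsHistory.append]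

variable [MeasurableSpace W]

theorem measurable_observe : Measurable (observe (W := W) (α := Fin 2) (β := Fin 2) t) := by
  unfold observe
  fun_prop

theorem ObsHistory.measurable_fill : Measurable (ObsHistory.fill (W := W) (t := t)) := by
  unfold ObsHistory.fill
  fun_prop

theorem ObsHistory.measurable_append (z : Fin 2 × I) :
    Measurable fun o : ObsHistory W t => o.append z := by
  refine Measurable.prodMk (by fun_prop) (measurable_pi_lambda _ fun i => ?_)
  refine Fin.lastCases ?_ (fun j => ?_) i
  · simp only [Fin.snoc_last]
    fun_prop
  · simp only [Fin.snoc_castSucc]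
    fun_prop

/-- The fibre of `f` through `h` is the preimage of a set of observations, and filling in dummy
column actions does not change the observation. Hence the dummy `0` is harmless. -/
theorem apply_fill_observe {X : Type*} [MeasurableSpace X] [MeasurableSingletonClass X]
    {f : History W (Fin 2) (Fin 2) t → X}
    (hf : Measurable[MeasurableSpace.comap
      (observe (W := W) (α := Fin 2) (β := Fin 2) t) inferInstance] f)
    (h : History W (Fin 2) (Fin 2) t) : f (ObsHistory.fill (observe t h)) = f h := by
  obtain ⟨s, -, hs⟩ := hf (measurableSet_singleton (f h))
  have h1 : h ∈ observe t ⁻¹' s := by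
    rw [hs]
    rfl
  have h2 : ObsHistory.fill (observe t h) ∈ observe t ⁻¹' s := h1
  rw [hs] at h2
  exact h2

end Observation

namespace LearningSequence

variable {W : Type*} [MeasurableSpace W] (S : LearningSequence W (Fin 2) (Fin 2))

/-- The probability of the row `a` in round `t + 1`, as a function of the observed history. -/
def rowProb (t : ℕ) (o : ObsHistory W t) (a : Fin 2) : ℝ := (S.minPolicy t o.fill).1 a

/-- The probability of the first column in round `t + 1`, as a function of the observed history. -/
def colProb (t : ℕ) (o : ObsHistory W t) : ℝ := (S.maxPolicy t o.fill).1 0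

/-- The law of the observed history of the first `t` rounds. -/
noncomputable def obsLaw (G : MatrixGame (Fin 2) (Fin 2)) (t : ℕ) : Measure (ObsHistory W t) :=
  (S.historyLaw G t).map (observe t)

instance isProbabilityMeasure_obsLaw (G : MatrixGame (Fin 2) (Fin 2)) (t : ℕ) :
    IsProbabilityMeasure (S.obsLaw G t) :=
  Measure.isProbabilityMeasure_map measurable_observe.aemeasurable

@[fun_prop]
theorem measurable_rowProb (t : ℕ) (a : Fin 2) : Measurable fun o => S.rowProb t o a :=
  (measurable_pi_apply a).comp (measurable_subtype_coe.comp
    ((S.measurable_minPolicy t).comp ObsHistory.measurable_fill))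

@[fun_prop]
theorem measurable_colProb (t : ℕ) : Measurable (S.colProb t) :=
  (measurable_pi_apply 0).comp (measurable_subtype_coe.comp
    ((S.measurable_maxPolicy t).comp ObsHistory.measurable_fill))

theorem rowProb_nonneg (t : ℕ) (o : ObsHistory W t) (a : Fin 2) : 0 ≤ S.rowProb t o a :=
  (stdSimplex_apply_mem_Icc _ a).1

theorem rowProb_mem_Icc (t : ℕ) (o : ObsHistory W t) (a : Fin 2) :
    S.rowProb t o a ∈ Set.Icc (0 : ℝ) 1 :=
  stdSimplex_apply_mem_Icc _ a

theorem sum_rowProb (t : ℕ) (o : ObsHistory W t) : ∑ a, S.rowProb t o a = 1 :=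
  (S.minPolicy t o.fill).2.2

theorem colProb_mem_Icc (t : ℕ) (o : ObsHistory W t) : S.colProb t o ∈ Set.Icc (0 : ℝ) 1 :=
  stdSimplex_apply_mem_Icc _ 0

variable (ε : Set.Icc (-1 / 12 : ℝ) (1 / 12))

theorem obsLaw_zero_eq (G G' : MatrixGame (Fin 2) (Fin 2)) : S.obsLaw G 0 = S.obsLaw G' 0 := rfl

/-- The law of the loss given the action of the min-player. -/
theorem sum_lintegral_lossLaw {x : ℝ} (hx : 0 ≤ x) (ν : stdSimplex ℝ (Fin 2)) (a : Fin 2)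
    {g : I → ℝ≥0∞} (hg : Measurable g) :
    ∑ b, ENNReal.ofReal (x * ν.1 b) * ∫⁻ ℓ, g ℓ ∂((hardGame ε).lossLaw a b : Measure I) =
      ENNReal.ofReal x * (ENNReal.ofReal (lossProb ε a (ν.1 0)) * g 1 +
        ENNReal.ofReal (1 - lossProb ε a (ν.1 0)) * g 0) := by
  have hε := ε.2
  have hy := stdSimplex_apply_mem_Icc ν 0
  have hν := ν.2.2
  rw [Fin.sum_univ_two] at hν
  have hν' : ν.1 1 = 1 - ν.1 0 := by linarith
  have key : ∀ {r s : ℝ} (hr : r ∈ Set.Icc (0 : ℝ) 1) (hs : s ∈ Set.Icc (0 : ℝ) 1),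
      ν.1 0 * r + ν.1 1 * s = lossProb ε a (ν.1 0) →
      ENNReal.ofReal (x * ν.1 0) * ∫⁻ ℓ, g ℓ ∂(bernoulliLoss r hr : Measure I) +
        ENNReal.ofReal (x * ν.1 1) * ∫⁻ ℓ, g ℓ ∂(bernoulliLoss s hs : Measure I) =
      ENNReal.ofReal x * (ENNReal.ofReal (lossProb ε a (ν.1 0)) * g 1 +
        ENNReal.ofReal (1 - lossProb ε a (ν.1 0)) * g 0) := by
    intro r s hr hs hrs
    have hy1 : 0 ≤ ν.1 1 := ν.2.1 1
    have e : 1 - lossProb ε a (ν.1 0) = ν.1 0 * (1 - r) + ν.1 1 * (1 - s) := by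
      rw [← hrs, hν']
      ring
    rw [lintegral_bernoulliLoss hr hg, lintegral_bernoulliLoss hs hg, e, ← hrs,
      ENNReal.ofReal_mul hx, ENNReal.ofReal_mul hx,
      ENNReal.ofReal_add (mul_nonneg hy.1 hr.1) (mul_nonneg hy1 hs.1),
      ENNReal.ofReal_add (mul_nonneg hy.1 (sub_nonneg.2 hr.2)) (mul_nonneg hy1 (sub_nonneg.2 hs.2)),
      ENNReal.ofReal_mul hy.1, ENNReal.ofReal_mul hy1, ENNReal.ofReal_mul hy.1,
      ENNReal.ofReal_mul hy1]
    ring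
  rw [Fin.sum_univ_two]
  fin_cases a
  · refine key (r := 2 / 3 - ε) (s := 1 / 3 + ε) _ _ ?_
    simp only [lossProb, hν', if_true, Fin.zero_eta]
    ring
  · refine key (r := 1 / 3) (s := 2 / 3) _ _ ?_
    simp only [lossProb, hν', Fin.mk_one, one_ne_zero, if_false]
    ring

theorem lintegral_stepKernel (t : ℕ) (h : History W (Fin 2) (Fin 2) t)
    (G : MatrixGame (Fin 2) (Fin 2)) {g : Fin 2 × Fin 2 × I → ℝ≥0∞} (hg : Measurable g) :
    ∫⁻ z, g z ∂(S.stepKernel G t h) =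
      ∑ a, ∑ b, ENNReal.ofReal ((S.minPolicy t h).1 a * (S.maxPolicy t h).1 b) *
        ∫⁻ ℓ, g (a, b, ℓ) ∂(G.lossLaw a b : Measure I) := by
  change ∫⁻ z, g z ∂(∑ a, ∑ b,
    ENNReal.ofReal ((S.minPolicy t h).1 a * (S.maxPolicy t h).1 b) •
    (G.lossLaw a b : Measure I).map (fun ℓ => (a, b, ℓ))) = _
  simp only [lintegral_finsetSum_measure, lintegral_smul_measure, smul_eq_mul]
  refine Finset.sum_congr rfl fun a _ => Finset.sum_congr rfl fun b _ => ?_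
  rw [lintegral_map hg (by fun_prop)]

variable {S}

/-- The expectation over one round of play, in terms of the observed history alone. -/
theorem lintegral_obsLaw_succ (hS : S.MaxActionsUnobserved) (t : ℕ)
    {g : ObsHistory W (t + 1) → ℝ≥0∞} (hg : Measurable g) :
    ∫⁻ o, g o ∂(S.obsLaw (hardGame ε) (t + 1)) =
      ∫⁻ o, ∑ a, ENNReal.ofReal (S.rowProb t o a) *
        (ENNReal.ofReal (lossProb ε a (S.colProb t o)) * g (o.append (a, 1)) +
        ENNReal.ofReal (1 - lossProb ε a (S.colProb t o)) * g (o.append (a, 0)))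
        ∂(S.obsLaw (hardGame ε) t) := by
  have happ := ObsHistory.measurable_append (W := W) (t := t)
  have hgo : Measurable fun x : History W (Fin 2) (Fin 2) (t + 1) => g (observe (t + 1) x) :=
    hg.comp measurable_observe
  have hge : Measurable fun x : History W (Fin 2) (Fin 2) t × (Fin 2 × Fin 2 × I) =>
      g (observe (t + 1) (extend t x)) := hgo.comp (measurable_extend t)
  have hgm : Measurable fun o : ObsHistory W t => ∑ a, ENNReal.ofReal (S.rowProb t o a) *
      (ENNReal.ofReal (lossProb ε a (S.colProb t o)) * g (o.append (a, 1)) +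
        ENNReal.ofReal (1 - lossProb ε a (S.colProb t o)) * g (o.append (a, 0))) := by
    fun_prop
  rw [obsLaw, obsLaw, lintegral_map hg measurable_observe, lintegral_map hgm measurable_observe,
    historyLaw, lintegral_map hgo (measurable_extend t), Measure.lintegral_compProd hge]
  refine lintegral_congr fun h => ?_
  have hgz : Measurable fun z : Fin 2 × Fin 2 × I => g (observe (t + 1) (extend t (h, z))) :=
    hge.comp measurable_prodMk_left
  rw [lintegral_stepKernel S t h _ hgz]
  refine Finset.sum_congr rfl fun a _ => ?_
  have hmin : (S.minPolicy t h).1 a = S.rowProb t (observe t h) a := by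
    rw [rowProb, apply_fill_observe (hS t).1]
  have hmax : (S.maxPolicy t h).1 0 = S.colProb t (observe t h) := by
    rw [colProb, apply_fill_observe (hS t).2]
  -- The integrand no longer sees the column `b`, so summing over `b` mixes the two Bernoulli laws
  -- of row `a` into one of parameter `lossProb`.
  simp only [observe_extend]
  have hga : Measurable fun ℓ : I =>
      g (ObsHistory.append (observe t h : ObsHistory W t) (a, ℓ)) := by
    simp only [← observe_extend h a 0]
    exact hgz.comp (by fun_prop)
  rw [sum_lintegral_lossLaw ε ((S.minPolicy t h).2.1 a) (S.maxPolicy t h) a hga, hmin, hmax]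

end LearningSequence

end BanditGame

/-! ### Likelihood ratios and the two-point bound -/

namespace BanditGame

/-- The square root of the likelihood ratio of a loss after the row `z.1`, for the games with
parameters `ε₂` and `ε₁`. -/
noncomputable def stepRatio (ε₁ ε₂ y : ℝ) (z : Fin 2 × I) : ℝ :=
  if z.2 = 1 then √(lossProb ε₂ z.1 y / lossProb ε₁ z.1 y)
  -- Bernoulli losses charge only `0` and `1`, so this branch matters only at loss `0`.
  else √((1 - lossProb ε₂ z.1 y) / (1 - lossProb ε₁ z.1 y))

theorem stepRatio_one (ε₁ ε₂ y : ℝ) (a : Fin 2) :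
    stepRatio ε₁ ε₂ y (a, 1) = √(lossProb ε₂ a y / lossProb ε₁ a y) :=
  if_pos rfl

theorem stepRatio_zero (ε₁ ε₂ y : ℝ) (a : Fin 2) :
    stepRatio ε₁ ε₂ y (a, 0) = √((1 - lossProb ε₂ a y) / (1 - lossProb ε₁ a y)) :=
  if_neg zero_ne_one

theorem stepRatio_nonneg (ε₁ ε₂ y : ℝ) (z : Fin 2 × I) : 0 ≤ stepRatio ε₁ ε₂ y z := by
  unfold stepRatio
  split_ifs <;> exact Real.sqrt_nonneg _

theorem measurable_stepRatio (ε₁ ε₂ : ℝ) :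
    Measurable fun x : ℝ × Fin 2 × I => stepRatio ε₁ ε₂ x.1 x.2 := by
  have hl : ∀ ε, Measurable fun x : ℝ × Fin 2 × I => lossProb ε x.2.1 x.1 := fun ε =>
    Measurable.ite (measurableSet_eq_fun (by fun_prop) (by fun_prop)) (by fun_prop) (by fun_prop)
  have h1 := hl ε₁
  have h2 := hl ε₂
  exact Measurable.ite (measurableSet_eq_fun (by fun_prop) (by fun_prop)) (by fun_prop)
    (by fun_prop)

section StepRatio

variable {ε₁ ε₂ y : ℝ} (h₁ : ε₁ ∈ Set.Icc (-1 / 12 : ℝ) (1 / 12))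
  (h₂ : ε₂ ∈ Set.Icc (-1 / 12 : ℝ) (1 / 12)) (hy : y ∈ Set.Icc (0 : ℝ) 1) (a : Fin 2)

include h₁ h₂ hy

theorem lossProb_mul_stepRatio_sq :
    lossProb ε₁ a y * stepRatio ε₁ ε₂ y (a, 1) ^ 2 = lossProb ε₂ a y := by
  have hp := (lossProb_mem_Icc h₁ hy a).1
  have hq := (lossProb_mem_Icc h₂ hy a).1
  rw [stepRatio_one, Real.sq_sqrt (div_nonneg (by linarith) (by linarith)),
    mul_div_cancel₀ _ (by linarith)]

theorem one_sub_lossProb_mul_stepRatio_sq :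
    (1 - lossProb ε₁ a y) * stepRatio ε₁ ε₂ y (a, 0) ^ 2 = 1 - lossProb ε₂ a y := by
  have hp := (lossProb_mem_Icc h₁ hy a).2
  have hq := (lossProb_mem_Icc h₂ hy a).2
  rw [stepRatio_zero, Real.sq_sqrt (div_nonneg (by linarith) (by linarith)),
    mul_div_cancel₀ _ (by linarith)]

/-- The Hellinger affinity of the two laws of a loss. -/
theorem hellinger_step_ge :
    1 - 4 * (ε₁ - ε₂) ^ 2 * (y - 1 / 2) ^ 2 ≤
      lossProb ε₁ a y * stepRatio ε₁ ε₂ y (a, 1) +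
        (1 - lossProb ε₁ a y) * stepRatio ε₁ ε₂ y (a, 0) := by
  have hp := lossProb_mem_Icc h₁ hy a
  have hq := lossProb_mem_Icc h₂ hy a
  have key : ∀ {p q : ℝ}, 0 < p → √(p * q) = p * √(q / p) := fun {p q} hp => by
    rw [show p * q = p ^ 2 * (q / p) by field_simp, Real.sqrt_mul (sq_nonneg p),
      Real.sqrt_sq hp.le]
  have h := one_sub_sq_sub_le_sqrt_mul_add hp hq
  rw [key (by linarith [hp.1]), key (by linarith [hp.2])] at h
  rw [stepRatio_one, stepRatio_zero]
  linarith [sq_lossProb_sub_le ε₁ ε₂ y a]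

end StepRatio

namespace LearningSequence

variable {W : Type*} [MeasurableSpace W]

/-- The square root of the likelihood ratio of an observed history, for the games with parameters
`ε₂` and `ε₁`. -/
noncomputable def rootRatio (S : LearningSequence W (Fin 2) (Fin 2)) (ε₁ ε₂ : ℝ) :
    (t : ℕ) → ObsHistory W t → ℝ
  | 0, _ => 1
  -- Only the loss contributes: the policies are the same functions of the history in both games, so
  -- the row probabilities cancel.
  | t + 1, o => S.rootRatio ε₁ ε₂ t (o.1, Fin.init o.2) *
      stepRatio ε₁ ε₂ (S.colProb t (o.1, Fin.init o.2)) (o.2 (Fin.last t))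

variable {S : LearningSequence W (Fin 2) (Fin 2)}

theorem rootRatio_append (ε₁ ε₂ : ℝ) (t : ℕ) (o : ObsHistory W t) (z : Fin 2 × I) :
    S.rootRatio ε₁ ε₂ (t + 1) (o.append z) =
      S.rootRatio ε₁ ε₂ t o * stepRatio ε₁ ε₂ (S.colProb t o) z := by
  simp [rootRatio, ObsHistory.append]

theorem rootRatio_nonneg (ε₁ ε₂ : ℝ) (t : ℕ) (o : ObsHistory W t) :
    0 ≤ S.rootRatio ε₁ ε₂ t o := by
  induction t with
  | zero => exact zero_le_one
  | succ t ih => exact mul_nonneg (ih _) (stepRatio_nonneg _ _ _ _)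

@[fun_prop]
theorem measurable_rootRatio (ε₁ ε₂ : ℝ) (t : ℕ) : Measurable (S.rootRatio ε₁ ε₂ t) := by
  induction t with
  | zero => exact measurable_const
  | succ t ih =>
    have hi : Measurable fun o : ObsHistory W (t + 1) => ((o.1, Fin.init o.2) : ObsHistory W t) :=
      Measurable.prodMk measurable_fst (measurable_pi_lambda _ fun i =>
        (measurable_pi_apply i.castSucc).comp measurable_snd)
    exact (ih.comp hi).mul ((measurable_stepRatio ε₁ ε₂).comp
      (((S.measurable_colProb t).comp hi).prodMk
        ((measurable_pi_apply (Fin.last t)).comp measurable_snd)))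

variable (hS : S.MaxActionsUnobserved) (ε₁ ε₂ : Set.Icc (-1 / 12 : ℝ) (1 / 12))

include hS

/-- Change of measure between the two games. By induction on the rounds, each one-round law for `ε₂`
is the one for `ε₁` weighted by `stepRatio ^ 2`; loss probabilities in `[1/4, 3/4]` keep the
quotients meaningful. -/
theorem lintegral_obsLaw_eq_lintegral_mul (t : ℕ) {g : ObsHistory W t → ℝ≥0∞}
    (hg : Measurable g) :
    ∫⁻ o, g o ∂(S.obsLaw (hardGame ε₂) t) =
      ∫⁻ o, ENNReal.ofReal (S.rootRatio ε₁ ε₂ t o ^ 2) * g o ∂(S.obsLaw (hardGame ε₁) t) := by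
  induction t with
  | zero =>
    rw [S.obsLaw_zero_eq (hardGame ε₂) (hardGame ε₁)]
    simp [rootRatio]
  | succ t ih =>
    have happ := ObsHistory.measurable_append (W := W) (t := t)
    rw [lintegral_obsLaw_succ _ hS t hg, lintegral_obsLaw_succ _ hS t (by fun_prop),
      ih (by fun_prop)]
    refine lintegral_congr fun o => ?_
    rw [Finset.mul_sum]
    refine Finset.sum_congr rfl fun a _ => ?_
    have hy := S.colProb_mem_Icc t o
    have hp := lossProb_mem_Icc ε₁.2 hy a
    rw [rootRatio_append, rootRatio_append, ← one_sub_lossProb_mul_stepRatio_sq ε₁.2 ε₂.2 hy a,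
      ← lossProb_mul_stepRatio_sq ε₁.2 ε₂.2 hy a, mul_pow, mul_pow,
      ENNReal.ofReal_mul (sq_nonneg _), ENNReal.ofReal_mul (sq_nonneg _),
      ENNReal.ofReal_mul (by linarith [hp.1]), ENNReal.ofReal_mul (by linarith [hp.2])]
    ring

theorem lintegral_rootRatio_sq (t : ℕ) :
    ∫⁻ o, ENNReal.ofReal (S.rootRatio ε₁ ε₂ t o ^ 2) ∂(S.obsLaw (hardGame ε₁) t) = 1 := by
  have h := lintegral_obsLaw_eq_lintegral_mul hS ε₁ ε₂ t (measurable_const (a := (1 : ℝ≥0∞)))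
  simpa using h.symm

/-- The loss of Hellinger affinity over one round of play. -/
theorem lintegral_rootRatio_le (t : ℕ) :
    ∫⁻ o, ENNReal.ofReal (S.rootRatio ε₁ ε₂ t o) ∂(S.obsLaw (hardGame ε₁) t) ≤
      ∫⁻ o, ENNReal.ofReal (S.rootRatio ε₁ ε₂ (t + 1) o) ∂(S.obsLaw (hardGame ε₁) (t + 1)) +
        ENNReal.ofReal (2 * ((ε₁ : ℝ) - ε₂) ^ 2) *
          (∫⁻ o, ENNReal.ofReal ((S.colProb t o - 1 / 2) ^ 2) ∂(S.obsLaw (hardGame ε₁) t) +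
            ∫⁻ o, ENNReal.ofReal ((S.colProb t o - 1 / 2) ^ 2) ∂(S.obsLaw (hardGame ε₂) t)) := by
  have happ := ObsHistory.measurable_append (W := W) (t := t)
  rw [lintegral_obsLaw_succ _ hS t (by fun_prop),
    -- Carrying the `ε₂` moment over to the `ε₁` law with weight `R²` makes the claim pointwise.
    lintegral_obsLaw_eq_lintegral_mul hS ε₁ ε₂ t (by fun_prop),
    ← lintegral_add_left (by fun_prop), ← lintegral_const_mul _ (by fun_prop),
    ← lintegral_add_right _ (by fun_prop)]
  refine lintegral_mono fun o => ?_
  have hy := S.colProb_mem_Icc t o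
  have hR := S.rootRatio_nonneg ε₁ ε₂ t o
  have hx := S.rowProb_nonneg t o
  have hΔ := sq_nonneg ((ε₁ : ℝ) - ε₂)
  have hd := sq_nonneg (S.colProb t o - 1 / 2)
  set y := S.colProb t o
  set R := S.rootRatio ε₁ ε₂ t o
  have hterm : ∀ a, ENNReal.ofReal (S.rowProb t o a) *
      (ENNReal.ofReal (lossProb ε₁ a y) *
          ENNReal.ofReal (S.rootRatio ε₁ ε₂ (t + 1) (o.append (a, 1))) +
        ENNReal.ofReal (1 - lossProb ε₁ a y) *
          ENNReal.ofReal (S.rootRatio ε₁ ε₂ (t + 1) (o.append (a, 0)))) =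
      ENNReal.ofReal (S.rowProb t o a * (R * (lossProb ε₁ a y * stepRatio ε₁ ε₂ y (a, 1) +
        (1 - lossProb ε₁ a y) * stepRatio ε₁ ε₂ y (a, 0)))) := by
    intro a
    have hp := lossProb_mem_Icc ε₁.2 hy a
    have hp0 : 0 ≤ lossProb ε₁ a y := by linarith [hp.1]
    have hp1 : 0 ≤ 1 - lossProb ε₁ a y := by linarith [hp.2]
    have hr1 := stepRatio_nonneg ε₁ ε₂ y (a, 1)
    have hr0 := stepRatio_nonneg ε₁ ε₂ y (a, 0)
    rw [rootRatio_append, rootRatio_append, ← ENNReal.ofReal_mul hp0, ← ENNReal.ofReal_mul hp1,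
      ← ENNReal.ofReal_add (by positivity) (by positivity), ← ENNReal.ofReal_mul (hx a)]
    congr 1
    ring
  have hnonneg : ∀ a, 0 ≤ S.rowProb t o a * (R * (lossProb ε₁ a y * stepRatio ε₁ ε₂ y (a, 1) +
        (1 - lossProb ε₁ a y) * stepRatio ε₁ ε₂ y (a, 0))) := by
    intro a
    have hp := lossProb_mem_Icc ε₁.2 hy a
    have hp0 : 0 ≤ lossProb ε₁ a y := by linarith [hp.1]
    have hp1 : 0 ≤ 1 - lossProb ε₁ a y := by linarith [hp.2]
    have hr1 := stepRatio_nonneg ε₁ ε₂ y (a, 1)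
    have hr0 := stepRatio_nonneg ε₁ ε₂ y (a, 0)
    have := hx a
    positivity
  have hsum : R * (1 - 4 * ((ε₁ : ℝ) - ε₂) ^ 2 * (y - 1 / 2) ^ 2) ≤
      ∑ a, S.rowProb t o a * (R * (lossProb ε₁ a y * stepRatio ε₁ ε₂ y (a, 1) +
        (1 - lossProb ε₁ a y) * stepRatio ε₁ ε₂ y (a, 0))) := by
    calc R * (1 - 4 * ((ε₁ : ℝ) - ε₂) ^ 2 * (y - 1 / 2) ^ 2)
        = ∑ a, S.rowProb t o a * (R * (1 - 4 * ((ε₁ : ℝ) - ε₂) ^ 2 * (y - 1 / 2) ^ 2)) := by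
          rw [← Finset.sum_mul, S.sum_rowProb, one_mul]
      _ ≤ _ := Finset.sum_le_sum fun a _ => mul_le_mul_of_nonneg_left
          (mul_le_mul_of_nonneg_left (hellinger_step_ge ε₁.2 ε₂.2 hy a) hR) (hx a)
  simp only [hterm]
  rw [← ENNReal.ofReal_sum_of_nonneg fun a _ => hnonneg a, ← ENNReal.ofReal_mul (sq_nonneg R),
    ← ENNReal.ofReal_add hd (by positivity), ← ENNReal.ofReal_mul (by positivity),
    ← ENNReal.ofReal_add (Finset.sum_nonneg fun a _ => hnonneg a) (by positivity)]
  refine ENNReal.ofReal_le_ofReal ?_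
  -- The affinity deficit carries the weight `R`, and `2R ≤ 1 + R²` splits it between the two games.
  nlinarith [mul_nonneg (mul_nonneg hΔ hd) (sq_nonneg (R - 1))]

theorem one_le_lintegral_rootRatio_add (t : ℕ) :
    1 ≤ ∫⁻ o, ENNReal.ofReal (S.rootRatio ε₁ ε₂ t o) ∂(S.obsLaw (hardGame ε₁) t) +
        ENNReal.ofReal (2 * ((ε₁ : ℝ) - ε₂) ^ 2) * ∑ s ∈ Finset.range t,
          (∫⁻ o, ENNReal.ofReal ((S.colProb s o - 1 / 2) ^ 2) ∂(S.obsLaw (hardGame ε₁) s) +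
            ∫⁻ o, ENNReal.ofReal ((S.colProb s o - 1 / 2) ^ 2) ∂(S.obsLaw (hardGame ε₂) s)) := by
  induction t with
  | zero => simp [rootRatio]
  | succ t ih =>
    rw [Finset.sum_range_succ, mul_add]
    refine ih.trans ((add_le_add_left (lintegral_rootRatio_le hS ε₁ ε₂ t) _).trans_eq ?_)
    ring

/-- A two-point lower bound: if the Hellinger affinity is close to `1`, the errors of the
min-player in the two games cannot both be small. -/
theorem ofReal_mul_lintegral_rootRatio_le (t : ℕ) :
    ENNReal.ofReal (|(ε₁ : ℝ) - ε₂| / 5) * (ENNReal.ofReal (3 / 4) *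
        ∫⁻ o, ENNReal.ofReal (S.rootRatio ε₁ ε₂ t o) ∂(S.obsLaw (hardGame ε₁) t)) ≤
      ∫⁻ o, ENNReal.ofReal |S.rowProb t o 0 * (1 / 3 - ε₁) - 1 / 6| ∂(S.obsLaw (hardGame ε₁) t) +
      ∫⁻ o, ENNReal.ofReal |S.rowProb t o 0 * (1 / 3 - ε₂) - 1 / 6| ∂(S.obsLaw (hardGame ε₂) t) +
      ENNReal.ofReal (|(ε₁ : ℝ) - ε₂| / 5) * ENNReal.ofReal (1 / 4) := by
  -- The constant becomes an integral, since `R²` has mean `1`, so that the scalar inequality for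
  -- `min 1 (R²)` can be applied under the integral sign.
  have h8 : ENNReal.ofReal (1 / 4) =
      ∫⁻ o, ENNReal.ofReal ((1 + S.rootRatio ε₁ ε₂ t o ^ 2) / 8) ∂(S.obsLaw (hardGame ε₁) t) := by
    have e : ∀ o, ENNReal.ofReal ((1 + S.rootRatio ε₁ ε₂ t o ^ 2) / 8) =
        ENNReal.ofReal (1 / 8) * (1 + ENNReal.ofReal (S.rootRatio ε₁ ε₂ t o ^ 2)) := fun o => by
      rw [← ENNReal.ofReal_one, ← ENNReal.ofReal_add zero_le_one (sq_nonneg _),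
        ← ENNReal.ofReal_mul (by norm_num)]
      congr 1
      ring
    simp only [e]
    rw [lintegral_const_mul _ (by fun_prop), lintegral_add_left (by fun_prop),
      lintegral_rootRatio_sq hS, lintegral_one, measure_univ, ← ENNReal.ofReal_one,
      ← ENNReal.ofReal_add zero_le_one zero_le_one, ← ENNReal.ofReal_mul (by norm_num)]
    norm_num
  rw [h8, lintegral_obsLaw_eq_lintegral_mul hS ε₁ ε₂ t (by fun_prop),
    ← lintegral_const_mul _ (by fun_prop), ← lintegral_const_mul _ (by fun_prop),
    ← lintegral_const_mul _ (by fun_prop), ← lintegral_add_left (by fun_prop),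
    ← lintegral_add_left (by fun_prop)]
  refine lintegral_mono fun o => ?_
  have hR := S.rootRatio_nonneg ε₁ ε₂ t o
  have hx := abs_rowProb_error_add_ge ε₁.2 ε₂.2 (S.rowProb_mem_Icc t o 0)
  have hs := three_quarters_mul_le_min_add (S.rootRatio ε₁ ε₂ t o)
  set R := S.rootRatio ε₁ ε₂ t o
  have hf1 := abs_nonneg (S.rowProb t o 0 * (1 / 3 - (ε₁ : ℝ)) - 1 / 6)
  have hf2 := abs_nonneg (S.rowProb t o 0 * (1 / 3 - (ε₂ : ℝ)) - 1 / 6)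
  have hΔ : 0 ≤ |(ε₁ : ℝ) - ε₂| / 5 := by positivity
  set f₁ := |S.rowProb t o 0 * (1 / 3 - (ε₁ : ℝ)) - 1 / 6|
  set f₂ := |S.rowProb t o 0 * (1 / 3 - (ε₂ : ℝ)) - 1 / 6|
  set δ := |(ε₁ : ℝ) - ε₂| / 5
  beta_reduce
  rw [← ENNReal.ofReal_mul (by norm_num), ← ENNReal.ofReal_mul hΔ,
    ← ENNReal.ofReal_mul (by positivity), ← ENNReal.ofReal_mul hΔ, ← ENNReal.ofReal_add hf1 (by positivity),
    ← ENNReal.ofReal_add (by positivity) (by positivity)]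
  refine ENNReal.ofReal_le_ofReal ?_
  have h1 : δ * min 1 (R ^ 2) ≤ f₁ + R ^ 2 * f₂ := by
    have hm0 : 0 ≤ min 1 (R ^ 2) := le_min zero_le_one (sq_nonneg R)
    calc δ * min 1 (R ^ 2) ≤ (f₁ + f₂) * min 1 (R ^ 2) := mul_le_mul_of_nonneg_right hx hm0
      _ = min 1 (R ^ 2) * f₁ + min 1 (R ^ 2) * f₂ := by ring
      _ ≤ 1 * f₁ + R ^ 2 * f₂ := add_le_add
          (mul_le_mul_of_nonneg_right (min_le_left _ _) hf1)
          (mul_le_mul_of_nonneg_right (min_le_right _ _) hf2)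
      _ = f₁ + R ^ 2 * f₂ := by rw [one_mul]
  nlinarith [mul_le_mul_of_nonneg_left hs hΔ]

end LearningSequence

end BanditGame

/-! ### Sums, powers and pigeonhole -/

namespace BanditGame

section Auxiliary

theorem sum_range_inv_sqrt_le (t : ℕ) :
    ∑ s ∈ Finset.range t, 1 / √((s : ℝ) + 1) ≤ 2 * √(t : ℝ) := by
  induction t with
  | zero => simp
  | succ t ih =>
    rw [Finset.sum_range_succ, Nat.cast_succ]
    have ha : √(t : ℝ) ^ 2 = t := Real.sq_sqrt (Nat.cast_nonneg t)
    have hb : √((t : ℝ) + 1) ^ 2 = t + 1 := Real.sq_sqrt (by positivity)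
    have hb0 : 0 < √((t : ℝ) + 1) := Real.sqrt_pos.2 (by positivity)
    -- The right-hand side telescopes.
    have h : 1 / √((t : ℝ) + 1) ≤ 2 * (√((t : ℝ) + 1) - √(t : ℝ)) := by
      rw [div_le_iff₀ hb0]
      nlinarith [sq_nonneg (√((t : ℝ) + 1) - √(t : ℝ))]
    linarith

theorem sum_range_ite_lt_le {c : ℝ} (hc : 0 ≤ c) (t T : ℕ) :
    ∑ s ∈ Finset.range t, (if s < T then c else 0) ≤ T * c := by
  rw [← Finset.sum_filter, Finset.sum_const, nsmul_eq_mul]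
  refine mul_le_mul_of_nonneg_right (Nat.cast_le.2 ?_) hc
  refine (Finset.card_le_card fun s hs => ?_).trans_eq (Finset.card_range T)
  exact Finset.mem_range.2 (Finset.mem_filter.1 hs).2

theorem rpow_neg_quarter_sq {x : ℝ} (hx : 0 ≤ x) : (x ^ (-1 / 4 : ℝ)) ^ 2 = 1 / √x := by
  rw [← Real.rpow_natCast, ← Real.rpow_mul hx, Real.sqrt_eq_rpow, one_div, ← Real.rpow_neg hx]
  norm_num

theorem rpow_neg_quarter_le {x d : ℝ} (hd : 0 < d) (hx : (1 / d) ^ 4 ≤ x) :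
    x ^ (-1 / 4 : ℝ) ≤ d := by
  refine (Real.rpow_le_rpow_of_nonpos (by positivity) hx (by norm_num)).trans_eq ?_
  rw [← Real.rpow_natCast, ← Real.rpow_mul (by positivity), one_div, Real.inv_rpow hd.le,
    ← Real.rpow_neg hd.le]
  norm_num

/-- An infinite bounded set of reals contains two different points at an arbitrarily small
distance. -/
theorem exists_ne_abs_sub_lt_of_infinite {a b : ℝ} {A : Set (Set.Icc a b)} (hA : A.Infinite)
    {δ : ℝ} (hδ : 0 < δ) : ∃ x ∈ A, ∃ y ∈ A, x ≠ y ∧ |(x : ℝ) - y| < δ := by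
  -- Pigeonhole on the finitely many cells of length `δ` that meet `[a, b]`.
  obtain ⟨x, hx, y, hy, hne, hxy⟩ := hA.exists_ne_map_eq_of_mapsTo
    (f := fun x : Set.Icc a b => ⌊(x : ℝ) / δ⌋) (t := Set.Icc ⌊a / δ⌋ ⌊b / δ⌋)
    (fun x _ => ⟨Int.floor_le_floor (div_le_div_of_nonneg_right x.2.1 hδ.le),
      Int.floor_le_floor (div_le_div_of_nonneg_right x.2.2 hδ.le)⟩) (Set.finite_Icc _ _)
  refine ⟨x, hx, y, hy, hne, ?_⟩
  have h := Int.abs_sub_lt_one_of_floor_eq_floor hxy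
  rwa [← sub_div, abs_div, abs_of_pos hδ, div_lt_one hδ] at h

theorem exists_infinite_of_forall_exists {X : Type*} [Uncountable X] {P : ℕ → X → Prop}
    (h : ∀ x, ∃ n, P n x) : ∃ n, {x | P n x}.Infinite := by
  by_contra! hfin
  have hu : (Set.univ : Set X) = ⋃ n, {x | P n x} := by
    ext x
    simpa using h x
  refine Set.not_countable_univ (α := X) ?_
  rw [hu]
  exact Set.countable_iUnion fun n => (hfin n).countable

end Auxiliary

/-! ### Consequences of the rate -/

namespace LearningSequence

variable {W : Type*} [MeasurableSpace W] {S : LearningSequence W (Fin 2) (Fin 2)}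
  {ε : Set.Icc (-1 / 12 : ℝ) (1 / 12)} {p : ℝ≥0∞} {t : ℕ} {r : ℝ}

theorem eLpNorm_obsLaw_le {q : ℝ≥0∞} (hqp : q ≤ p) {G : MatrixGame (Fin 2) (Fin 2)}
    {f : ObsHistory W t → ℝ} (hf : Measurable f) (hfg : ∀ h, |f (observe t h)| ≤ S.gap G t h) :
    eLpNorm f q (S.obsLaw G t) ≤ eLpNorm (S.gap G t) p (S.historyLaw G t) := by
  rw [obsLaw, eLpNorm_map_measure hf.aestronglyMeasurable measurable_observe.aemeasurable]
  exact (eLpNorm_le_eLpNorm_of_exponent_le hqp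
    (hf.comp measurable_observe).aestronglyMeasurable).trans (eLpNorm_mono_real hfg)

/-- The second moment is where `p ≥ 2` enters: the `L²` norm is below the `L^p` norm under a
probability measure. The factor `36` is the square of the `6` in `abs_colProb_sub_half_le`. -/
theorem lintegral_sq_colProb_sub_half_le (hS : S.MaxActionsUnobserved) (hp : 2 ≤ p) (hr : 0 ≤ r)
    (h : eLpNorm (S.gap (hardGame ε) t) p (S.historyLaw (hardGame ε) t) ≤ ENNReal.ofReal r) :
    ∫⁻ o, ENNReal.ofReal ((S.colProb t o - 1 / 2) ^ 2) ∂(S.obsLaw (hardGame ε) t) ≤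
      ENNReal.ofReal (36 * r ^ 2) := by
  have h2 : eLpNorm (fun o => (S.colProb t o - 1 / 2) / 6) 2 (S.obsLaw (hardGame ε) t) ≤
      ENNReal.ofReal r := by
    refine (eLpNorm_obsLaw_le hp (by fun_prop) fun x => ?_).trans h
    rw [colProb, apply_fill_observe (hS t).2, abs_div, abs_of_pos (show (0 : ℝ) < 6 by norm_num)]
    exact abs_colProb_sub_half_le ε _ _
  have h3 := eLpNorm_nnreal_pow_eq_lintegral (μ := S.obsLaw (hardGame ε) t)
    (f := fun o => (S.colProb t o - 1 / 2) / 6) (p := 2) two_ne_zero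
  have e : ∀ o, ENNReal.ofReal ((S.colProb t o - 1 / 2) ^ 2) =
      ENNReal.ofReal 36 * ‖(S.colProb t o - 1 / 2) / 6‖ₑ ^ ((2 : NNReal) : ℝ) := fun o => by
    rw [Real.enorm_eq_ofReal_abs, NNReal.coe_ofNat, ENNReal.rpow_two,
      ← ENNReal.ofReal_pow (abs_nonneg _), sq_abs, ← ENNReal.ofReal_mul (by norm_num)]
    congr 1
    ring
  simp only [e]
  rw [lintegral_const_mul _ (by fun_prop), ← h3, ENNReal.ofReal_mul (by norm_num),
    ENNReal.ofReal_pow hr, NNReal.coe_ofNat, ENNReal.rpow_two]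
  gcongr
  exact h2

theorem lintegral_abs_rowProb_error_le (hS : S.MaxActionsUnobserved) (hp : 1 ≤ p)
    (h : eLpNorm (S.gap (hardGame ε) t) p (S.historyLaw (hardGame ε) t) ≤ ENNReal.ofReal r) :
    ∫⁻ o, ENNReal.ofReal |S.rowProb t o 0 * (1 / 3 - ε) - 1 / 6| ∂(S.obsLaw (hardGame ε) t) ≤
      ENNReal.ofReal r := by
  have h1 : eLpNorm (fun o => S.rowProb t o 0 * (1 / 3 - ε) - 1 / 6) 1
      (S.obsLaw (hardGame ε) t) ≤ ENNReal.ofReal r := by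
    refine (eLpNorm_obsLaw_le hp (by fun_prop) fun x => ?_).trans h
    rw [rowProb, apply_fill_observe (hS t).1]
    exact abs_rowProb_error_le ε _ _
  rw [eLpNorm_one_eq_lintegral_enorm] at h1
  simpa only [Real.enorm_eq_ofReal_abs] using h1

theorem lintegral_sq_colProb_sub_half_le_one (ε : Set.Icc (-1 / 12 : ℝ) (1 / 12)) (t : ℕ) :
    ∫⁻ o, ENNReal.ofReal ((S.colProb t o - 1 / 2) ^ 2) ∂(S.obsLaw (hardGame ε) t) ≤
      ENNReal.ofReal (1 / 4) := by
  refine (lintegral_mono (g := fun _ => ENNReal.ofReal (1 / 4)) fun o =>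
    ENNReal.ofReal_le_ofReal ?_).trans_eq (by simp)
  obtain ⟨h0, h1⟩ := S.colProb_mem_Icc t o
  nlinarith

/-- The rounds before `T` carry no guarantee and are charged the trivial bound `1/4`; the later ones
sum like `1 / √(s + 1)`. -/
theorem sum_lintegral_sq_colProb_sub_half_le (hS : S.MaxActionsUnobserved) (hp : 2 ≤ p) {c : ℝ}
    (hc : 0 ≤ c) {T : ℕ} (t : ℕ)
    (h : ∀ s ≥ T, eLpNorm (S.gap (hardGame ε) s) p (S.historyLaw (hardGame ε) s) ≤
      ENNReal.ofReal (c * ((s + 1 : ℕ) : ℝ) ^ (-1 / 4 : ℝ))) :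
    ∑ s ∈ Finset.range t,
      ∫⁻ o, ENNReal.ofReal ((S.colProb s o - 1 / 2) ^ 2) ∂(S.obsLaw (hardGame ε) s) ≤
      ENNReal.ofReal (72 * c ^ 2 * √(t : ℝ) + T * (1 / 4)) := by
  have hs : ∀ s, ∫⁻ o, ENNReal.ofReal ((S.colProb s o - 1 / 2) ^ 2) ∂(S.obsLaw (hardGame ε) s) ≤
      ENNReal.ofReal (36 * c ^ 2 * (1 / √((s : ℝ) + 1)) + if s < T then 1 / 4 else 0) := by
    intro s
    split_ifs with hsT
    · refine (lintegral_sq_colProb_sub_half_le_one ε s).trans (ENNReal.ofReal_le_ofReal ?_)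
      exact le_add_of_nonneg_left (by positivity)
    · refine (lintegral_sq_colProb_sub_half_le hS hp (by positivity)
        (h s (not_lt.1 hsT))).trans_eq ?_
      rw [mul_pow, rpow_neg_quarter_sq (by positivity), Nat.cast_succ, add_zero, mul_assoc]
  refine (Finset.sum_le_sum fun s _ => hs s).trans ?_
  rw [← ENNReal.ofReal_sum_of_nonneg fun s _ => by split_ifs <;> positivity]
  refine ENNReal.ofReal_le_ofReal ?_
  rw [Finset.sum_add_distrib, ← Finset.mul_sum]
  have h1 := mul_le_mul_of_nonneg_left (sum_range_inv_sqrt_le t)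
    (show 0 ≤ 36 * c ^ 2 by positivity)
  have h2 := sum_range_ite_lt_le (show (0 : ℝ) ≤ 1 / 4 by norm_num) t T
  linarith

/-- If the rate `c * t ^ (-1 / 4)` holds from round `T` on in two games, their parameters cannot be
separated better than the information from the first `t` rounds allows. -/
theorem abs_sub_mul_le_of_rate (hS : S.MaxActionsUnobserved) (hp : 2 ≤ p)
    (ε₁ ε₂ : Set.Icc (-1 / 12 : ℝ) (1 / 12)) {c : ℝ} (hc : 0 ≤ c) {T t : ℕ} (hTt : T ≤ t)
    (h₁ : ∀ s ≥ T, eLpNorm (S.gap (hardGame ε₁) s) p (S.historyLaw (hardGame ε₁) s) ≤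
      ENNReal.ofReal (c * ((s + 1 : ℕ) : ℝ) ^ (-1 / 4 : ℝ)))
    (h₂ : ∀ s ≥ T, eLpNorm (S.gap (hardGame ε₂) s) p (S.historyLaw (hardGame ε₂) s) ≤
      ENNReal.ofReal (c * ((s + 1 : ℕ) : ℝ) ^ (-1 / 4 : ℝ))) :
    |(ε₁ : ℝ) - ε₂| / 5 * (1 / 2 - 3 / 4 *
        (((ε₁ : ℝ) - ε₂) ^ 2 * (288 * c ^ 2 * √(t : ℝ) + T))) ≤
      2 * (c * ((t + 1 : ℕ) : ℝ) ^ (-1 / 4 : ℝ)) := by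
  have hB := one_le_lintegral_rootRatio_add hS ε₁ ε₂ t
  have hF := ofReal_mul_lintegral_rootRatio_le hS ε₁ ε₂ t
  set B := ∫⁻ o, ENNReal.ofReal (S.rootRatio ε₁ ε₂ t o) ∂(S.obsLaw (hardGame ε₁) t)
  set η := ((ε₁ : ℝ) - ε₂) ^ 2 * (288 * c ^ 2 * √(t : ℝ) + T) with hη
  set δ := |(ε₁ : ℝ) - ε₂| / 5 with hδ
  set r := c * ((t + 1 : ℕ) : ℝ) ^ (-1 / 4 : ℝ) with hr
  have hδ0 : 0 ≤ δ := by positivity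
  have hr0 : 0 ≤ r := by positivity
  -- Two games, each with `72 c² √t + T/4`, times the factor `2 Δ²`, give `η`.
  have hB' : ENNReal.ofReal (1 - η) ≤ B := by
    rw [ENNReal.ofReal_sub _ (by positivity), ENNReal.ofReal_one, tsub_le_iff_right]
    refine hB.trans ?_
    gcongr
    rw [Finset.sum_add_distrib]
    refine (mul_le_mul_right (add_le_add (sum_lintegral_sq_colProb_sub_half_le hS hp hc t h₁)
      (sum_lintegral_sq_colProb_sub_half_le hS hp hc t h₂)) _).trans_eq ?_
    rw [← ENNReal.ofReal_add (by positivity) (by positivity), ← ENNReal.ofReal_mul (by positivity)]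
    congr 1
    rw [hη]
    ring
  have hp1 : 1 ≤ p := one_le_two.trans hp
  have key : ENNReal.ofReal (δ * (3 / 4 * (1 - η))) ≤ ENNReal.ofReal (r + r + δ * (1 / 4)) := by
    rw [ENNReal.ofReal_mul hδ0, ENNReal.ofReal_mul (by norm_num),
      ENNReal.ofReal_add (by positivity) (by positivity), ENNReal.ofReal_add hr0 hr0,
      ENNReal.ofReal_mul hδ0]
    calc _ ≤ ENNReal.ofReal δ * (ENNReal.ofReal (3 / 4) * B) := by gcongr
      _ ≤ _ := hF
      _ ≤ _ := by
        gcongr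
        · exact lintegral_abs_rowProb_error_le hS hp1 (h₁ t hTt)
        · exact lintegral_abs_rowProb_error_le hS hp1 (h₂ t hTt)
  rw [ENNReal.ofReal_le_ofReal_iff (by positivity)] at key
  linarith

end LearningSequence

end BanditGame

/-! ### Choice of two games and of the horizon -/

/-- No learning sequence that does not observe the actions of the max-player has, on every one of
the games `hardGame ε`, even asymptotically, the `L^p` last-iterate rate `t^(-1/4) / 236`. -/
theorem mainTheorem2 {W : Type*} [MeasurableSpace W]
    (S : BanditGame.LearningSequence W (Fin 2) (Fin 2)) (hS : S.MaxActionsUnobserved)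
    (p : ℝ≥0∞) (hp : 2 < p) :
    ¬ ∀ ε : Set.Icc (-1 / 12 : ℝ) (1 / 12),
      S.AsymptoticLastIterateConvergence (BanditGame.hardGame ε) p
        (fun t : ℕ => 1 / 236 * (t : ℝ) ^ (-1 / 4 : ℝ)) := by
  intro hrate
  have hlt : (-1 / 12 : ℝ) < 1 / 12 := by norm_num
  have : Uncountable (Set.Icc (-1 / 12 : ℝ) (1 / 12)) := by
    rw [← not_countable_iff, Set.countable_coe_iff]
    exact Cardinal.Real.Icc_countable_iff.not.2 hlt.not_ge
  -- Uncountably many games and countably many starting rounds: some `T` serves infinitely many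
  -- games.
  obtain ⟨T, hT⟩ := BanditGame.exists_infinite_of_forall_exists hrate
  have hT1 : (0 : ℝ) < T + 1 := by positivity
  -- A distance this small relative to `T` makes the information from the first `T` rounds
  -- negligible and puts the horizon below beyond `T`.
  obtain ⟨ε₁, h₁, ε₂, h₂, hne, hδ⟩ := BanditGame.exists_ne_abs_sub_lt_of_infinite hT
    (show (0 : ℝ) < 1 / (100 * (T + 1)) by positivity)
  have hΔ : 0 < |(ε₁ : ℝ) - ε₂| := abs_pos.2 (sub_ne_zero.2 (Subtype.coe_injective.ne hne))
  rw [lt_div_iff₀ (by positivity)] at hδ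
  have hrate' := fun {t : ℕ} (hTt : T ≤ t) => S.abs_sub_mul_le_of_rate hS hp.le ε₁ ε₂
    (c := 1 / 236) (by norm_num) hTt h₁ h₂
  rw [← sq_abs] at hrate'
  set Δ := |(ε₁ : ℝ) - ε₂|
  have hΔT : 20 * (T + 1 : ℝ) ≤ 1 / (5 * Δ) := by
    rw [le_div_iff₀ (by positivity)]
    linarith
  -- The horizon is `t = ⌈a⁴⌉`: then `(t + 1)^(-1/4) ≤ 5Δ`, while `Δ² √t` is close to `1/25`.
  set a := 1 / (5 * Δ) with ha
  have haΔ : a * Δ = 1 / 5 := by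
    rw [ha]
    field_simp
  have ha1 : 1 ≤ a := by linarith [Nat.cast_nonneg (α := ℝ) T]
  have ht := Nat.le_ceil (a ^ 4)
  have ht' := Nat.ceil_lt_add_one (show 0 ≤ a ^ 4 by positivity)
  set t := ⌈a ^ 4⌉₊
  have hTt : T ≤ t := by
    have h4 : a ≤ a ^ 4 := le_self_pow₀ ha1 (by norm_num)
    have : (T : ℝ) ≤ t := by linarith [Nat.cast_nonneg (α := ℝ) T]
    exact_mod_cast this
  have hmain := hrate' hTt
  have hu : ((t + 1 : ℕ) : ℝ) ^ (-1 / 4 : ℝ) ≤ 5 * Δ :=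
    BanditGame.rpow_neg_quarter_le (by positivity) (by push_cast; linarith)
  have hsqrt : √(t : ℝ) ≤ a ^ 2 + 1 := Real.sqrt_le_iff.2 ⟨by positivity, by nlinarith⟩
  have hΔ1 : Δ ≤ 1 / 100 := by nlinarith [Nat.cast_nonneg (α := ℝ) T]
  have hη1 : Δ ^ 2 * √(t : ℝ) ≤ 1 / 20 := by
    calc Δ ^ 2 * √(t : ℝ) ≤ Δ ^ 2 * (a ^ 2 + 1) := by gcongr
      _ = (a * Δ) ^ 2 + Δ ^ 2 := by ring
      _ ≤ 1 / 20 := by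
        rw [haΔ]
        nlinarith
  have hη2 : Δ ^ 2 * T ≤ 1 / 100 := by
    have : Δ * T ≤ 1 / 100 := by nlinarith
    nlinarith
  -- In `hmain` the left side exceeds `9Δ/100`, but the right side is at most `10Δ/236`.
  nlinarith
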